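/- Let $D\ge 4$, let $M,Q\in\mathbb R$ with $Q\neq 0$, and put $f(r)=1-\dfrac{2M}{r^{D-3}}+\dfrac{Q^2}{r^{2(D-3)}}$. On the part of $\mathbb R\times(0,\infty)\times S^{D-2}$ where $f(r)\ne0$, consider the $D$-dimensional Reissner–Nordström metric $$ds^2=-f(r)\,dt^2+f(r)^{-1}\,dr^2+r^2\,d\Omega_{D-2}^2 ,$$ where $d\Omega^2_{D-2}$ is the round metric of the unit sphere $S^{D-2}$, together with the gauge field $A=-Q\,r^{3-D}\,dt$ and its field strength $F_{\mu\nu}=\partial_\mu A_\nu-\partial_\nu A_\mu$. Let $C_{\mu\nu\rho\sigma}$ be the Weyl tensor of this metric, with the curvature conventions $R_{\mu\nu\rho\sigma}=g_{\mu\tau}R^\tau{}_{\nu\rho\sigma}$, where $R^\mu{}_{\nu\rho\sigma}=\partial_\rho\Gamma^\mu_{\sigma\nu}-\partial_\sigma\Gamma^\mu_{\rho\nu}+\Gamma^\mu_{\rho\tau}\Gamma^\tau_{\sigma\nu}-\Gamma^\mu_{\sigma\tau}\Gamma^\tau_{\rho\nu}$ and $R_{\nu\sigma}=R^\mu{}_{\nu\mu\sigma}$.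 Let $C_{\mu\nu\rho\sigma}[F]$ be the tensor obtained from $$F_{\mu\nu}F_{\rho\sigma}-F_{\rho\mu}F_{\nu\sigma}-\frac{6}{D-2}\,g_{\mu\rho}F_\nu{}^\lambda F_{\sigma\lambda}+\frac{3}{(D-1)(D-2)}\,g_{\mu\rho}g_{\nu\sigma}F^{\kappa\lambda}F_{\kappa\lambda}$$ by antisymmetrising with unit weight in $\mu,\nu$ and in $\rho,\sigma$. Then everywhere on this region $$C_{\mu\nu\rho\sigma}=\Lambda(r)\,C_{\mu\nu\rho\sigma}[F],\qquad \Lambda(r)=\frac{2(D-2)}{3(D-3)^2}\left((2D-5)-(D-1)\frac{M\,r^{D-3}}{Q^2}\right).$$ -/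

import Mathlib

noncomputable section

namespace RNDouble

/-! ## Tensor calculus in a coordinate chart

`ι` is the finite set of coordinate indices, a point has coordinates `x : ι → ℝ`, and a metric is
given by its matrix of components `g x μ ν`.  The dimension of spacetime is `Fintype.card ι`. -/

section Tensor

variable {ι : Type} [Fintype ι] [DecidableEq ι]

/-- The partial derivative `∂_μ φ` at `x`. -/
def pd (μ : ι) (φ : (ι → ℝ) → ℝ) (x : ι → ℝ) : ℝ :=
  fderiv ℝ φ x (Pi.single μ 1)

/-- The Christoffel symbol `Γ^μ_{ρσ}` of the Levi-Civita connection,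
`Γ^μ_{ρσ} = ½ g^{μα} (∂_ρ g_{ασ} + ∂_σ g_{αρ} - ∂_α g_{ρσ})`. -/
def christoffel (g : (ι → ℝ) → Matrix ι ι ℝ) (μ ρ σ : ι) (x : ι → ℝ) : ℝ :=
  1 / 2 * ∑ α, (g x)⁻¹ μ α *
    (pd ρ (fun y => g y α σ) x + pd σ (fun y => g y α ρ) x - pd α (fun y => g y ρ σ) x)

/-- The Riemann tensor with first index raised,
`R^μ_{νρσ} = ∂_ρ Γ^μ_{σν} - ∂_σ Γ^μ_{ρν} + Γ^μ_{ρτ} Γ^τ_{σν} - Γ^μ_{στ} Γ^τ_{ρν}`. -/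
def riemannUp (g : (ι → ℝ) → Matrix ι ι ℝ) (μ ν ρ σ : ι) (x : ι → ℝ) : ℝ :=
  pd ρ (christoffel g μ σ ν) x - pd σ (christoffel g μ ρ ν) x
    + ∑ τ, (christoffel g μ ρ τ x * christoffel g τ σ ν x
            - christoffel g μ σ τ x * christoffel g τ ρ ν x)

/-- The Riemann tensor with all indices down, `R_{μνρσ} = g_{μτ} R^τ_{νρσ}`. -/
def riemann (g : (ι → ℝ) → Matrix ι ι ℝ) (μ ν ρ σ : ι) (x : ι → ℝ) : ℝ :=
  ∑ τ, g x μ τ * riemannUp g τ ν ρ σ x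

/-- The Ricci tensor `R_{νσ} = R^μ_{νμσ}`. -/
def ricci (g : (ι → ℝ) → Matrix ι ι ℝ) (ν σ : ι) (x : ι → ℝ) : ℝ :=
  ∑ μ, riemannUp g μ ν μ σ x

/-- The scalar curvature `R = g^{νσ} R_{νσ}`. -/
def scalarCurvature (g : (ι → ℝ) → Matrix ι ι ℝ) (x : ι → ℝ) : ℝ :=
  ∑ ν, ∑ σ, (g x)⁻¹ ν σ * ricci g ν σ x

/-- The Weyl tensor `C_{μνρσ}[g]`, the trace-free part of the Riemann tensor in dimension
`n = Fintype.card ι`. -/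
def weyl (g : (ι → ℝ) → Matrix ι ι ℝ) (μ ν ρ σ : ι) (x : ι → ℝ) : ℝ :=
  riemann g μ ν ρ σ x
    - 1 / ((Fintype.card ι : ℝ) - 2) *
        (g x μ ρ * ricci g σ ν x - g x μ σ * ricci g ρ ν x
          - g x ν ρ * ricci g σ μ x + g x ν σ * ricci g ρ μ x)
    + scalarCurvature g x / (((Fintype.card ι : ℝ) - 1) * ((Fintype.card ι : ℝ) - 2)) *
        (g x μ ρ * g x σ ν - g x μ σ * g x ρ ν)

/-- The field strength `F_{μν} = ∂_μ A_ν - ∂_ν A_μ` of a one-form `A`. -/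
def fieldStrength (A : (ι → ℝ) → ι → ℝ) (x : ι → ℝ) (μ ν : ι) : ℝ :=
  pd μ (fun y => A y ν) x - pd ν (fun y => A y μ) x

/-- `F_μ · F_ν = F_μ^λ F_{νλ} = g^{κλ} F_{μκ} F_{νλ}` at a point, where `g` and `F` are the
components of the metric and of the two-form at that point. -/
def dot1 (g F : Matrix ι ι ℝ) (μ ν : ι) : ℝ :=
  ∑ κ, ∑ l, g⁻¹ κ l * F μ κ * F ν l

/-- `F · F = F^{μν} F_{μν} = g^{μν} F_μ · F_ν`. -/
def dot2 (g F : Matrix ι ι ℝ) : ℝ :=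
  ∑ μ, ∑ ν, g⁻¹ μ ν * dot1 g F μ ν

/-- Antisymmetrisation with unit weight in the first pair and in the second pair of indices. -/
def antisymPairs (T : ι → ι → ι → ι → ℝ) (μ ν ρ σ : ι) : ℝ :=
  1 / 4 * (T μ ν ρ σ - T ν μ ρ σ - T μ ν σ ρ + T ν μ σ ρ)

/-- The doubling `C_{μνρσ}[F]` of a two-form `F` in dimension `D = Fintype.card ι`:
`F_{μν} F_{ρσ} - F_{ρμ} F_{νσ} - 6/(D-2) g_{μρ} F_ν · F_σ + 3/((D-1)(D-2)) g_{μρ} g_{νσ} F · F`,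
antisymmetrised with unit weight in `μ, ν` and in `ρ, σ`. -/
def doubling (g F : Matrix ι ι ℝ) : ι → ι → ι → ι → ℝ :=
  antisymPairs fun μ ν ρ σ =>
    F μ ν * F ρ σ - F ρ μ * F ν σ
      - 6 / ((Fintype.card ι : ℝ) - 2) * (g μ ρ * dot1 g F ν σ)
      + 3 / (((Fintype.card ι : ℝ) - 1) * ((Fintype.card ι : ℝ) - 2)) *
          (g μ ρ * g ν σ * dot2 g F)

end Tensor

/-! ## The Reissner–Nordström solution

The spacetime is `ℝ × (0, ∞) × S^{D-2}`.  Polar coordinates identify `(0, ∞) × S^{D-2}` with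
`ℝ^{D-1} ∖ {0}` by `(r, ω) ↦ r ω`, and this gives global coordinates `(t, x)` on the spacetime. -/

/-- Coordinate indices: `Sum.inl ()` is the index of `t`, and `Sum.inr i` the index of the `i`-th
coordinate of the point `r ω` of `ℝ^{D-1}`. -/
abbrev Idx (D : ℕ) : Type := Unit ⊕ Fin (D - 1)

/-- The time function `t`. -/
def time {D : ℕ} (x : Idx D → ℝ) : ℝ := x (Sum.inl ())

/-- The radial function `r`. -/
def radius {D : ℕ} (x : Idx D → ℝ) : ℝ := √(∑ i : Fin (D - 1), x (Sum.inr i) ^ 2)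

/-- The components of the projection `ω` to the unit sphere `S^{D-2}` of `ℝ^{D-1}`. -/
def sphereProj {D : ℕ} (k : Fin (D - 1)) (x : Idx D → ℝ) : ℝ := x (Sum.inr k) / radius x

/-- The round metric `dΩ²_{D-2} = ∑_k dω_k ⊗ dω_k` of the unit sphere, pulled back along `ω`. -/
def sphereMetric {D : ℕ} (x : Idx D → ℝ) (μ ν : Idx D) : ℝ :=
  ∑ k : Fin (D - 1), pd μ (sphereProj k) x * pd ν (sphereProj k) x

/-- `f(r) = 1 - 2M / r^{D-3} + Q² / r^{2(D-3)}`. -/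
def rnF (D : ℕ) (M Q r : ℝ) : ℝ :=
  1 - 2 * M / r ^ (D - 3) + Q ^ 2 / r ^ (2 * (D - 3))

/-- The metric `ds² = -f(r) dt² + f(r)⁻¹ dr² + r² dΩ²_{D-2}`. -/
def rnMetric (D : ℕ) (M Q : ℝ) (x : Idx D → ℝ) : Matrix (Idx D) (Idx D) ℝ :=
  Matrix.of fun μ ν =>
    -rnF D M Q (radius x) * (pd μ time x * pd ν time x)
      + (rnF D M Q (radius x))⁻¹ * (pd μ radius x * pd ν radius x)
      + radius x ^ 2 * sphereMetric x μ ν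

/-- The gauge field `A = -(Q / r^{D-3}) dt`. -/
def rnGauge (D : ℕ) (Q : ℝ) (x : Idx D → ℝ) (μ : Idx D) : ℝ :=
  -(Q / radius x ^ (D - 3)) * pd μ time x

/-- `Λ(r) = 2(D-2) / (3(D-3)²) · ((2D-5) - (D-1) M r^{D-3} / Q²)`. -/
def rnLambda (D : ℕ) (M Q r : ℝ) : ℝ :=
  2 * ((D : ℝ) - 2) / (3 * ((D : ℝ) - 3) ^ 2) *
    ((2 * (D : ℝ) - 5) - ((D : ℝ) - 1) * (M * r ^ (D - 3) / Q ^ 2))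

end RNDouble

end

/-! In the coordinates `(t, r ω)` the form `r² dΩ²` is the Euclidean metric minus `dt² + dr²`, that
is, the projector `sph` orthogonal to `dt` and `dr`. Hence the metric is `-f dt² + f⁻¹ dr² + sph`,
and every tensor involved is a polynomial in `dt`, `dr`, `sph` with radial coefficients. This class
is closed under differentiation, because the Hessian of `r` is `sph / r` (`hasGrad_drForm`), and
under contraction (`sum_frame_mul`), so the curvature is computed without angular coordinates and
for a general `f`.

Spherical symmetry leaves one algebraic Weyl tensor up to scale, `staticWeyl`. The Weyl tensor is
`(D-3)/(2(D-1)) (f'' - 2f'/r + 2(f-1)/r²)` times it (`weyl_staticMetric`). The field strength is `q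
dr ∧ dt`, and its doubling is `3(D-3)/(2(D-1)) q²` times it (`doubling_staticMetric`). The quotient
`(f'' - 2f'/r + 2(f-1)/r²) / (3q²)` is `Λ`: the operator in the numerator multiplies a term `r^(-k)`
of `f - 1` by `(k+1)(k+2)/r²`, and `q = (D-3) Q / r^(D-2)`. -/

noncomputable section
namespace RNDouble

/-! ### Calculus of partial derivatives. -/

section Gradient

variable {ι : Type} [DecidableEq ι]

/-- `φ` is differentiable at `x` with partial derivatives `v μ`. -/
def HasGrad (φ : (ι → ℝ) → ℝ) (v : ι → ℝ) (x : ι → ℝ) : Prop :=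
  ∃ L : (ι → ℝ) →L[ℝ] ℝ, HasFDerivAt φ L x ∧ ∀ μ, L (Pi.single μ 1) = v μ

theorem HasGrad.pd {φ : (ι → ℝ) → ℝ} {v x : ι → ℝ} (h : HasGrad φ v x) (μ : ι) :
    pd μ φ x = v μ := by
  obtain ⟨L, hL, hv⟩ := h
  rw [RNDouble.pd, hL.fderiv, hv]

theorem HasGrad.congr {φ ψ : (ι → ℝ) → ℝ} {v x : ι → ℝ} (h : HasGrad φ v x)
    (hψ : ψ =ᶠ[nhds x] φ) : HasGrad ψ v x := by
  obtain ⟨L, hL, hv⟩ := h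
  exact ⟨L, hL.congr_of_eventuallyEq hψ, hv⟩

theorem HasGrad.congr_grad {φ : (ι → ℝ) → ℝ} {v w x : ι → ℝ} (h : HasGrad φ v x)
    (hw : ∀ μ, v μ = w μ) : HasGrad φ w x := by
  obtain ⟨L, hL, hv⟩ := h
  exact ⟨L, hL, fun μ => (hv μ).trans (hw μ)⟩

theorem hasGrad_const (c : ℝ) (x : ι → ℝ) : HasGrad (fun _ => c) (fun _ => 0) x :=
  ⟨0, hasFDerivAt_const c x, fun _ => rfl⟩

theorem hasGrad_coord (i : ι) (x : ι → ℝ) :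
    HasGrad (fun y => y i) (fun μ => if μ = i then 1 else 0) x :=
  ⟨ContinuousLinearMap.proj i, hasFDerivAt_apply i x, fun μ => by
    simp [Pi.single_apply, eq_comm]⟩

variable [Fintype ι]

theorem HasGrad.add {φ ψ : (ι → ℝ) → ℝ} {v w x : ι → ℝ} (h : HasGrad φ v x)
    (k : HasGrad ψ w x) : HasGrad (fun y => φ y + ψ y) (fun μ => v μ + w μ) x := by
  obtain ⟨L, hL, hv⟩ := h
  obtain ⟨K, hK, hw⟩ := k
  exact ⟨L + K, hL.add hK, fun μ => by simp [hv, hw]⟩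

theorem HasGrad.sub {φ ψ : (ι → ℝ) → ℝ} {v w x : ι → ℝ} (h : HasGrad φ v x)
    (k : HasGrad ψ w x) : HasGrad (fun y => φ y - ψ y) (fun μ => v μ - w μ) x := by
  obtain ⟨L, hL, hv⟩ := h
  obtain ⟨K, hK, hw⟩ := k
  exact ⟨L - K, hL.sub hK, fun μ => by simp [hv, hw]⟩

theorem HasGrad.mul {φ ψ : (ι → ℝ) → ℝ} {v w x : ι → ℝ} (h : HasGrad φ v x)
    (k : HasGrad ψ w x) :
    HasGrad (fun y => φ y * ψ y) (fun μ => φ x * w μ + ψ x * v μ) x := by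
  obtain ⟨L, hL, hv⟩ := h
  obtain ⟨K, hK, hw⟩ := k
  exact ⟨φ x • K + ψ x • L, hL.mul hK, fun μ => by simp [hv, hw]⟩

theorem HasGrad.comp {φ : (ι → ℝ) → ℝ} {p : ℝ → ℝ} {p' : ℝ} {v x : ι → ℝ}
    (hp : HasDerivAt p p' (φ x)) (h : HasGrad φ v x) :
    HasGrad (fun y => p (φ y)) (fun μ => p' * v μ) x := by
  obtain ⟨L, hL, hv⟩ := h
  exact ⟨p' • L, hp.comp_hasFDerivAt x hL, fun μ => by simp [hv]⟩

theorem HasGrad.sum {κ : Type} (s : Finset κ) {φ : κ → (ι → ℝ) → ℝ} {v : κ → ι → ℝ}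
    {x : ι → ℝ} (h : ∀ k ∈ s, HasGrad (φ k) (v k) x) :
    HasGrad (fun y => ∑ k ∈ s, φ k y) (fun μ => ∑ k ∈ s, v k μ) x := by
  classical
  induction s using Finset.induction_on with
  | empty => simpa using hasGrad_const 0 x
  | insert a s ha ih =>
    simp only [Finset.sum_insert ha]
    exact (h a (Finset.mem_insert_self a s)).add
      (ih fun k hk => h k (Finset.mem_insert_of_mem hk))

end Gradient

/-! ### The frame `dt`, `dr`, `sph` and its derivatives. -/

section Frame

variable {D : ℕ}

/-- The components of `dt`. -/
def dtForm (μ : Idx D) : ℝ := if μ = Sum.inl () then 1 else 0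

/-- The components of `dr`. -/
def drForm (x : Idx D → ℝ) (μ : Idx D) : ℝ :=
  Sum.elim (fun _ => 0) (fun i => x (Sum.inr i) / radius x) μ

/-- The Kronecker delta. -/
def kron (μ ν : Idx D) : ℝ := if μ = ν then 1 else 0

/-- The components of `r² dΩ²`: the projection orthogonal to `dt` and `dr`. -/
def sph (x : Idx D → ℝ) (μ ν : Idx D) : ℝ :=
  kron μ ν - dtForm μ * dtForm ν - drForm x μ * drForm x ν

theorem kron_comm (μ ν : Idx D) : kron μ ν = kron ν μ := by
  simp only [kron, eq_comm]

theorem sph_comm (x : Idx D → ℝ) (μ ν : Idx D) : sph x μ ν = sph x ν μ := by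
  rw [sph, sph, kron_comm]; ring

theorem radius_sq (x : Idx D → ℝ) :
    radius x ^ 2 = ∑ i : Fin (D - 1), x (Sum.inr i) ^ 2 :=
  Real.sq_sqrt (Finset.sum_nonneg fun _ _ => sq_nonneg _)

theorem continuous_radius : Continuous (radius : (Idx D → ℝ) → ℝ) := by
  unfold radius; fun_prop

theorem eventually_radius_pos {x : Idx D → ℝ} (hr : 0 < radius x) :
    ∀ᶠ y in nhds x, 0 < radius y :=
  continuous_radius.continuousAt.eventually (lt_mem_nhds hr)

theorem sum_kron_mul (μ : Idx D) (φ : Idx D → ℝ) : ∑ τ, kron μ τ * φ τ = φ μ := by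
  simp [kron]

theorem sum_dtForm_mul (φ : Idx D → ℝ) : ∑ τ, dtForm τ * φ τ = φ (Sum.inl ()) := by
  simp [dtForm]

theorem sum_drForm_mul_drForm {x : Idx D → ℝ} (hr : 0 < radius x) :
    ∑ τ, drForm x τ * drForm x τ = 1 := by
  simp only [Fintype.sum_sum_type, drForm, Sum.elim_inl, Sum.elim_inr]
  have h := radius_sq x
  have : ∑ i : Fin (D - 1), x (Sum.inr i) / radius x * (x (Sum.inr i) / radius x)
      = (∑ i : Fin (D - 1), x (Sum.inr i) ^ 2) / radius x ^ 2 := by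
    rw [Finset.sum_div]
    exact Finset.sum_congr rfl fun i _ => by ring
  rw [this, ← h]
  simp [hr.ne']

/-- For the Euclidean pairing `dt` and `dr` are orthonormal and `sph` is the complementary
projector. The coefficients are arbitrary reals, so they can absorb any factor carrying free
indices; nearly all later contractions are instances. -/
theorem sum_frame_mul {x : Idx D → ℝ} (hr : 0 < radius x) (ρ σ : Idx D)
    (a₀ a₁ a₂ b₀ b₁ b₂ : ℝ) :
    ∑ τ, (a₀ * dtForm τ + a₁ * drForm x τ + a₂ * sph x ρ τ) *
        (b₀ * dtForm τ + b₁ * drForm x τ + b₂ * sph x τ σ) =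
      a₀ * b₀ + a₁ * b₁ + a₂ * b₂ * sph x ρ σ := by
  have hTT : ∑ τ : Idx D, dtForm τ * dtForm τ = 1 := by rw [sum_dtForm_mul]; simp [dtForm]
  have hTN : ∑ τ : Idx D, dtForm τ * drForm x τ = 0 := by rw [sum_dtForm_mul]; simp [drForm]
  have hNN := sum_drForm_mul_drForm hr
  have hEE : ∑ τ, kron ρ τ * kron τ σ = kron ρ σ := sum_kron_mul ρ _
  have hET : ∑ τ, kron ρ τ * dtForm τ = dtForm ρ := sum_kron_mul ρ _
  have hEN : ∑ τ, kron ρ τ * drForm x τ = drForm x ρ := sum_kron_mul ρ _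
  have hTE : ∑ τ, dtForm τ * kron τ σ = dtForm σ := by
    simp only [kron_comm _ σ, mul_comm _ (kron σ _)]
    exact sum_kron_mul σ _
  have hNE : ∑ τ, drForm x τ * kron τ σ = drForm x σ := by
    simp only [kron_comm _ σ, mul_comm _ (kron σ _)]
    exact sum_kron_mul σ _
  have key : ∀ τ, (a₀ * dtForm τ + a₁ * drForm x τ + a₂ * sph x ρ τ) *
        (b₀ * dtForm τ + b₁ * drForm x τ + b₂ * sph x τ σ) =
      (a₀ - a₂ * dtForm ρ) * (b₀ - b₂ * dtForm σ) * (dtForm τ * dtForm τ)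
      + ((a₀ - a₂ * dtForm ρ) * (b₁ - b₂ * drForm x σ)
          + (a₁ - a₂ * drForm x ρ) * (b₀ - b₂ * dtForm σ)) * (dtForm τ * drForm x τ)
      + (a₁ - a₂ * drForm x ρ) * (b₁ - b₂ * drForm x σ) * (drForm x τ * drForm x τ)
      + a₂ * b₂ * (kron ρ τ * kron τ σ)
      + a₂ * (b₀ - b₂ * dtForm σ) * (kron ρ τ * dtForm τ)
      + a₂ * (b₁ - b₂ * drForm x σ) * (kron ρ τ * drForm x τ)
      + b₂ * (a₀ - a₂ * dtForm ρ) * (dtForm τ * kron τ σ)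
      + b₂ * (a₁ - a₂ * drForm x ρ) * (drForm x τ * kron τ σ) := by
    intro τ; simp only [sph]; ring
  rw [Finset.sum_congr rfl fun τ _ => key τ]
  simp only [Finset.sum_add_distrib, ← Finset.mul_sum, hTT, hTN, hNN, hEE, hET, hEN, hTE,
    hNE, sph]
  ring

theorem sum_sph_self (hD : 4 ≤ D) {x : Idx D → ℝ} (hr : 0 < radius x) :
    ∑ τ, sph x τ τ = (D : ℝ) - 2 := by
  have hTT : ∑ τ : Idx D, dtForm τ * dtForm τ = 1 := by rw [sum_dtForm_mul]; simp [dtForm]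
  simp only [sph, Finset.sum_sub_distrib, hTT, sum_drForm_mul_drForm hr]
  have : ((D - 1 : ℕ) : ℝ) = D - 1 := by rw [Nat.cast_sub (by omega)]; simp
  simp [kron, this]
  ring

theorem card_idx (hD : 4 ≤ D) : (Fintype.card (Idx D) : ℝ) = D := by
  have : Fintype.card (Idx D) = D := by simp; omega
  rw [this]

theorem hasGrad_radius {x : Idx D → ℝ} (hr : 0 < radius x) :
    HasGrad radius (drForm x) x := by
  have hs : HasGrad (fun y : Idx D → ℝ => ∑ i : Fin (D - 1), y (Sum.inr i) * y (Sum.inr i)) _ x :=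
    HasGrad.sum Finset.univ fun i _ => (hasGrad_coord (Sum.inr i) x).mul (hasGrad_coord _ x)
  have hrad : ∀ y : Idx D → ℝ,
      radius y = √(∑ i : Fin (D - 1), y (Sum.inr i) * y (Sum.inr i)) := by
    intro y; simp only [radius, sq]
  have hne : ∑ i : Fin (D - 1), x (Sum.inr i) * x (Sum.inr i) ≠ 0 := by
    intro h; rw [hrad, h] at hr; simp at hr
  have h := HasGrad.comp
    (φ := fun y : Idx D → ℝ => ∑ i : Fin (D - 1), y (Sum.inr i) * y (Sum.inr i))
    (Real.hasDerivAt_sqrt hne) hs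
  have e : (radius : (Idx D → ℝ) → ℝ) =
      fun y => √(∑ i : Fin (D - 1), y (Sum.inr i) * y (Sum.inr i)) := funext hrad
  rw [← hrad, ← e] at h
  refine h.congr_grad fun μ => ?_
  rcases μ with _ | i
  · simp [drForm]
  · simp [drForm, Finset.sum_add_distrib]
    ring

theorem hasGrad_time (x : Idx D → ℝ) : HasGrad time dtForm x :=
  hasGrad_coord (Sum.inl ()) x

theorem hasGrad_radial {p : ℝ → ℝ} {p' : ℝ} {x : Idx D → ℝ} (hr : 0 < radius x)
    (hp : HasDerivAt p p' (radius x)) :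
    HasGrad (fun y => p (radius y)) (fun μ => p' * drForm x μ) x :=
  HasGrad.comp hp (hasGrad_radius hr)

/-- The Hessian of `r`: moving radially or in time leaves the unit radial covector fixed, moving
tangentially turns it at rate `1/r`. -/
theorem hasGrad_drForm {x : Idx D → ℝ} (hr : 0 < radius x) (ν : Idx D) :
    HasGrad (fun y => drForm y ν) (fun μ => sph x μ ν / radius x) x := by
  rcases ν with u | i
  · refine (hasGrad_const 0 x).congr_grad fun μ => ?_
    simp [sph, kron, dtForm, drForm]
  · have h := (hasGrad_coord (Sum.inr i) x).mul
      (hasGrad_radial hr (hasDerivAt_inv hr.ne'))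
    refine (h.congr (Filter.Eventually.of_forall fun y => ?_)).congr_grad fun μ => ?_
    · simp [drForm, div_eq_mul_inv]
    · have := hr.ne'
      simp only [sph, kron, dtForm, drForm, Sum.elim_inr, reduceCtorEq, if_false]
      field_simp
      ring

theorem hasGrad_sph {x : Idx D → ℝ} (hr : 0 < radius x) (ν ρ : Idx D) :
    HasGrad (fun y => sph y ν ρ)
      (fun μ => -(sph x μ ν * drForm x ρ + sph x μ ρ * drForm x ν) / radius x) x :=
  ((hasGrad_const _ x).sub ((hasGrad_drForm hr ν).mul (hasGrad_drForm hr ρ))).congr_grad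
    fun μ => by ring

end Frame

/-! ### Curvature of `-f dt² + f⁻¹ dr² + r² dΩ²`. -/

section StaticMetric

variable {D : ℕ}

/-- A second projector term is needed to lower the index of the Riemann tensor, which carries both
`sph τ ρ` and `sph τ σ`. -/
theorem sum_frame_mul_add {x : Idx D → ℝ} (hr : 0 < radius x) (μ ρ σ : Idx D)
    (a₀ a₁ a₂ b₀ b₁ b₂ b₃ : ℝ) :
    ∑ τ, (a₀ * dtForm τ + a₁ * drForm x τ + a₂ * sph x μ τ) *
        (b₀ * dtForm τ + b₁ * drForm x τ + b₂ * sph x τ ρ + b₃ * sph x τ σ) =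
      a₀ * b₀ + a₁ * b₁ + a₂ * b₂ * sph x μ ρ + a₂ * b₃ * sph x μ σ := by
  have h₁ := sum_frame_mul hr μ ρ a₀ a₁ a₂ b₀ b₁ b₂
  have h₂ := sum_frame_mul hr μ σ a₀ a₁ a₂ 0 0 b₃
  have : ∀ τ, (a₀ * dtForm τ + a₁ * drForm x τ + a₂ * sph x μ τ) *
        (b₀ * dtForm τ + b₁ * drForm x τ + b₂ * sph x τ ρ + b₃ * sph x τ σ) =
      (a₀ * dtForm τ + a₁ * drForm x τ + a₂ * sph x μ τ) *
        (b₀ * dtForm τ + b₁ * drForm x τ + b₂ * sph x τ ρ) +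
      (a₀ * dtForm τ + a₁ * drForm x τ + a₂ * sph x μ τ) *
        (0 * dtForm τ + 0 * drForm x τ + b₃ * sph x τ σ) := fun τ => by ring
  rw [Finset.sum_congr rfl fun τ _ => this τ, Finset.sum_add_distrib, h₁, h₂]
  ring

/-- The static spherically symmetric metric `-f(r) dt² + f(r)⁻¹ dr² + r² dΩ²`. -/
def staticMetric (f : ℝ → ℝ) (x : Idx D → ℝ) : Matrix (Idx D) (Idx D) ℝ :=
  Matrix.of fun μ ν =>
    -f (radius x) * (dtForm μ * dtForm ν) + (f (radius x))⁻¹ * (drForm x μ * drForm x ν)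
      + sph x μ ν

theorem staticMetric_apply (f : ℝ → ℝ) (x : Idx D → ℝ) (μ ν : Idx D) :
    staticMetric f x μ ν =
      -f (radius x) * (dtForm μ * dtForm ν) + (f (radius x))⁻¹ * (drForm x μ * drForm x ν)
        + sph x μ ν := rfl

theorem staticMetric_inv {f : ℝ → ℝ} {x : Idx D → ℝ} (hr : 0 < radius x)
    (hf : f (radius x) ≠ 0) (μ ν : Idx D) :
    (staticMetric f x)⁻¹ μ ν =
      -(f (radius x))⁻¹ * (dtForm μ * dtForm ν) + f (radius x) * (drForm x μ * drForm x ν)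
        + sph x μ ν := by
  have h : staticMetric f x * (Matrix.of fun μ ν =>
      -(f (radius x))⁻¹ * (dtForm μ * dtForm ν) + f (radius x) * (drForm x μ * drForm x ν)
        + sph x μ ν) = 1 := by
    ext μ ν
    have h₁ := sum_frame_mul hr μ ν (-f (radius x) * dtForm μ) ((f (radius x))⁻¹ * drForm x μ) 1
      (-(f (radius x))⁻¹ * dtForm ν) (f (radius x) * drForm x ν) 1
    rw [Matrix.mul_apply]
    simp only [staticMetric_apply, Matrix.of_apply]
    rw [Finset.sum_congr rfl fun τ _ => ?_, h₁, Matrix.one_apply]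
    · change _ = kron μ ν
      simp only [sph]
      field_simp
      ring
    · ring
  rw [Matrix.inv_eq_right_inv h]
  rfl

theorem hasGrad_staticMetric {f : ℝ → ℝ} {f' : ℝ} {x : Idx D → ℝ} (hr : 0 < radius x)
    (hf : f (radius x) ≠ 0) (h₁ : HasDerivAt f f' (radius x)) (ρ σ : Idx D) :
    HasGrad (fun y => staticMetric f y ρ σ)
      (fun α => -f' * drForm x α * dtForm ρ * dtForm σ
        - f' / f (radius x) ^ 2 * drForm x α * drForm x ρ * drForm x σ
        + ((f (radius x))⁻¹ - 1) / radius x *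
          (sph x α ρ * drForm x σ + sph x α σ * drForm x ρ)) x := by
  have h := (((hasGrad_radial hr h₁.neg).mul (hasGrad_const (dtForm ρ * dtForm σ) x)).add
    ((hasGrad_radial hr (h₁.inv hf)).mul
      ((hasGrad_drForm hr ρ).mul (hasGrad_drForm hr σ)))).add (hasGrad_sph hr ρ σ)
  refine (h.congr (Filter.Eventually.of_forall fun y => ?_)).congr_grad fun α => ?_
  · simp [staticMetric_apply]
  · simp only [Pi.inv_apply]
    ring

theorem christoffel_staticMetric {f : ℝ → ℝ} {f' : ℝ} {x : Idx D → ℝ} (hr : 0 < radius x)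
    (hf : f (radius x) ≠ 0) (h₁ : HasDerivAt f f' (radius x)) (μ ρ σ : Idx D) :
    christoffel (staticMetric f) μ ρ σ x =
      f' / (2 * f (radius x)) * (dtForm μ * (drForm x ρ * dtForm σ + drForm x σ * dtForm ρ)
          - drForm x μ * (drForm x ρ * drForm x σ))
        + f (radius x) * f' / 2 * (drForm x μ * (dtForm ρ * dtForm σ))
        + (1 - f (radius x)) / radius x * (drForm x μ * sph x ρ σ) := by
  simp only [christoffel, (hasGrad_staticMetric hr hf h₁ _ _).pd, staticMetric_inv hr hf]
  -- In the bracket the terms in `sph α ρ` and `sph α σ` cancel, hence the final `0`; the two copies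
  -- of `sph ρ σ` multiply `drForm x α`.
  have h := sum_frame_mul hr μ ρ (-(f (radius x))⁻¹ * dtForm μ) (f (radius x) * drForm x μ) 1
    (-f' * (drForm x ρ * dtForm σ + drForm x σ * dtForm ρ))
    (f' * (dtForm ρ * dtForm σ) - f' / f (radius x) ^ 2 * (drForm x ρ * drForm x σ)
      + 2 * (((f (radius x))⁻¹ - 1) / radius x) * sph x ρ σ) 0
  rw [Finset.sum_congr rfl fun α _ => ?_, h]
  · have := hr.ne'
    field_simp
    ring
  · rw [sph_comm x σ α, sph_comm x ρ α, sph_comm x σ ρ]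
    ring

theorem hasGrad_christoffel {f f₁ : ℝ → ℝ} {f₂ : ℝ} {x : Idx D → ℝ} (hr : 0 < radius x)
    (hf : f (radius x) ≠ 0) (h₁ : ∀ s, 0 < s → HasDerivAt f (f₁ s) s)
    (h₂ : HasDerivAt f₁ f₂ (radius x)) (μ ρ σ : Idx D) :
    HasGrad (christoffel (staticMetric f) μ ρ σ)
      (fun κ =>
        (f₂ * f (radius x) - f₁ (radius x) ^ 2) / (2 * f (radius x) ^ 2) * drForm x κ *
            (dtForm μ * (drForm x ρ * dtForm σ + drForm x σ * dtForm ρ)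
              - drForm x μ * (drForm x ρ * drForm x σ))
        + f₁ (radius x) / (2 * f (radius x)) *
            (dtForm μ * (sph x κ ρ * dtForm σ + sph x κ σ * dtForm ρ)
              - (sph x κ μ * (drForm x ρ * drForm x σ)
                + drForm x μ * (sph x κ ρ * drForm x σ + drForm x ρ * sph x κ σ))) / radius x
        + (f₁ (radius x) ^ 2 + f (radius x) * f₂) / 2 * drForm x κ *
            (drForm x μ * (dtForm ρ * dtForm σ))
        + f (radius x) * f₁ (radius x) / 2 * (sph x κ μ * (dtForm ρ * dtForm σ)) / radius x
        + (-f₁ (radius x) * radius x - (1 - f (radius x))) / radius x ^ 2 * drForm x κ *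
            (drForm x μ * sph x ρ σ)
        + (1 - f (radius x)) / radius x ^ 2 * (sph x κ μ * sph x ρ σ
            - drForm x μ * (sph x κ ρ * drForm x σ + sph x κ σ * drForm x ρ))) x := by
  have hd := h₁ _ hr
  have hT := fun ν : Idx D => hasGrad_const (dtForm ν) x
  have hN := hasGrad_drForm hr
  have p₁ := hasGrad_radial hr (h₂.div (hd.const_mul 2) (mul_ne_zero two_ne_zero hf))
  have p₂ := hasGrad_radial hr ((hd.mul h₂).div_const 2)
  have p₃ := hasGrad_radial hr ((hd.const_sub 1).div (hasDerivAt_id _) hr.ne')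
  have h := ((p₁.mul (((hT μ).mul (((hN ρ).mul (hT σ)).add ((hN σ).mul (hT ρ)))).sub
      ((hN μ).mul ((hN ρ).mul (hN σ))))).add
    (p₂.mul ((hN μ).mul ((hT ρ).mul (hT σ))))).add
    (p₃.mul ((hN μ).mul (hasGrad_sph hr ρ σ)))
  refine (h.congr ?_).congr_grad fun κ => ?_
  -- Differentiating the closed formula for the symbols requires it near `x`, and its conditions `r
  -- > 0` and `f ≠ 0` are open.
  · have hcont : ∀ᶠ y in nhds x, f (radius y) ≠ 0 :=
      (hd.continuousAt.comp (f := radius) continuous_radius.continuousAt).eventually_ne hf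
    filter_upwards [eventually_radius_pos hr, hcont] with y hy hfy
    rw [christoffel_staticMetric hy hfy (h₁ _ hy)]
    simp
  · have := hr.ne'
    simp only [Pi.mul_apply, Pi.div_apply, id]
    field_simp
    ring

theorem riemannUp_staticMetric {f f₁ : ℝ → ℝ} {f₂ : ℝ} {x : Idx D → ℝ} (hr : 0 < radius x)
    (hf : f (radius x) ≠ 0) (h₁ : ∀ s, 0 < s → HasDerivAt f (f₁ s) s)
    (h₂ : HasDerivAt f₁ f₂ (radius x)) (μ ν ρ σ : Idx D) :
    riemannUp (staticMetric f) μ ν ρ σ x =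
      f₂ / 2 * ((-(f (radius x))⁻¹ * dtForm μ * drForm x ν - f (radius x) * drForm x μ * dtForm ν)
          * (dtForm ρ * drForm x σ - drForm x ρ * dtForm σ))
      + f₁ (radius x) / (2 * radius x) *
          (-(dtForm μ * (dtForm ρ * sph x ν σ - dtForm σ * sph x ν ρ))
            + f (radius x) * dtForm ν * (dtForm σ * sph x μ ρ - dtForm ρ * sph x μ σ))
      - f₁ (radius x) / (2 * radius x) *
          (drForm x μ * (drForm x ρ * sph x ν σ - drForm x σ * sph x ν ρ)
            + (f (radius x))⁻¹ * drForm x ν * (drForm x σ * sph x μ ρ - drForm x ρ * sph x μ σ))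
      + (1 - f (radius x)) / radius x ^ 2 * (sph x μ ρ * sph x ν σ - sph x μ σ * sph x ν ρ) := by
  simp only [riemannUp, (hasGrad_christoffel hr hf h₁ h₂ _ _ _).pd, Finset.sum_sub_distrib]
  have key : ∀ ρ σ : Idx D, ∑ τ, christoffel (staticMetric f) μ ρ τ x *
      christoffel (staticMetric f) τ σ ν x =
      f₁ (radius x) / (2 * f (radius x)) * (drForm x σ * dtForm ν + drForm x ν * dtForm σ) *
        (f₁ (radius x) / (2 * f (radius x)) * (dtForm μ * drForm x ρ)
          + f (radius x) * f₁ (radius x) / 2 * (drForm x μ * dtForm ρ))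
      + f₁ (radius x) / (2 * f (radius x)) * (dtForm μ * dtForm ρ - drForm x μ * drForm x ρ) *
        (-(f₁ (radius x) / (2 * f (radius x))) * (drForm x σ * drForm x ν)
          + f (radius x) * f₁ (radius x) / 2 * (dtForm σ * dtForm ν)
          + (1 - f (radius x)) / radius x * sph x σ ν) := by
    intro ρ σ
    simp only [christoffel_staticMetric hr hf (h₁ _ hr)]
    have h := sum_frame_mul hr ρ σ
      (f₁ (radius x) / (2 * f (radius x)) * (dtForm μ * drForm x ρ)
          + f (radius x) * f₁ (radius x) / 2 * (drForm x μ * dtForm ρ))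
      (f₁ (radius x) / (2 * f (radius x)) * (dtForm μ * dtForm ρ - drForm x μ * drForm x ρ))
      ((1 - f (radius x)) / radius x * drForm x μ)
      (f₁ (radius x) / (2 * f (radius x)) * (drForm x σ * dtForm ν + drForm x ν * dtForm σ))
      (-(f₁ (radius x) / (2 * f (radius x))) * (drForm x σ * drForm x ν)
          + f (radius x) * f₁ (radius x) / 2 * (dtForm σ * dtForm ν)
          + (1 - f (radius x)) / radius x * sph x σ ν) 0
    rw [Finset.sum_congr rfl fun α _ => ?_, h]
    · ring
    · ring
  rw [key, key, sph_comm x ρ μ, sph_comm x σ μ, sph_comm x σ ρ, sph_comm x ρ ν, sph_comm x σ ν]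
  have := hr.ne'
  generalize f (radius x) = a at *
  field_simp
  ring

theorem riemann_staticMetric {f f₁ : ℝ → ℝ} {f₂ : ℝ} {x : Idx D → ℝ} (hr : 0 < radius x)
    (hf : f (radius x) ≠ 0) (h₁ : ∀ s, 0 < s → HasDerivAt f (f₁ s) s)
    (h₂ : HasDerivAt f₁ f₂ (radius x)) (μ ν ρ σ : Idx D) :
    riemann (staticMetric f) μ ν ρ σ x =
      f₂ / 2 * ((dtForm μ * drForm x ν - drForm x μ * dtForm ν)
          * (dtForm ρ * drForm x σ - drForm x ρ * dtForm σ))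
      + f₁ (radius x) / (2 * radius x) * f (radius x) *
          (dtForm μ * (dtForm ρ * sph x ν σ - dtForm σ * sph x ν ρ)
            + dtForm ν * (dtForm σ * sph x μ ρ - dtForm ρ * sph x μ σ))
      - f₁ (radius x) / (2 * radius x) * (f (radius x))⁻¹ *
          (drForm x μ * (drForm x ρ * sph x ν σ - drForm x σ * sph x ν ρ)
            + drForm x ν * (drForm x σ * sph x μ ρ - drForm x ρ * sph x μ σ))
      + (1 - f (radius x)) / radius x ^ 2 * (sph x μ ρ * sph x ν σ - sph x μ σ * sph x ν ρ) := by
  simp only [riemann, riemannUp_staticMetric hr hf h₁ h₂, staticMetric_apply]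
  have h := sum_frame_mul_add hr μ ρ σ (-f (radius x) * dtForm μ)
    ((f (radius x))⁻¹ * drForm x μ) 1
    (-(f₂ / 2 * (f (radius x))⁻¹ * drForm x ν * (dtForm ρ * drForm x σ - drForm x ρ * dtForm σ))
      - f₁ (radius x) / (2 * radius x) * (dtForm ρ * sph x ν σ - dtForm σ * sph x ν ρ))
    (-(f₂ / 2 * f (radius x) * dtForm ν * (dtForm ρ * drForm x σ - drForm x ρ * dtForm σ))
      - f₁ (radius x) / (2 * radius x) * (drForm x ρ * sph x ν σ - drForm x σ * sph x ν ρ))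
    (f₁ (radius x) / (2 * radius x) *
        (f (radius x) * dtForm ν * dtForm σ - (f (radius x))⁻¹ * drForm x ν * drForm x σ)
      + (1 - f (radius x)) / radius x ^ 2 * sph x ν σ)
    (-(f₁ (radius x) / (2 * radius x) *
        (f (radius x) * dtForm ν * dtForm ρ - (f (radius x))⁻¹ * drForm x ν * drForm x ρ))
      - (1 - f (radius x)) / radius x ^ 2 * sph x ν ρ)
  rw [Finset.sum_congr rfl fun α _ => ?_, h]
  · have := hr.ne'
    generalize f (radius x) = a at *
    field_simp
    ring
  · ring

theorem ricci_staticMetric (hD : 4 ≤ D) {f f₁ : ℝ → ℝ} {f₂ : ℝ} {x : Idx D → ℝ}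
    (hr : 0 < radius x)
    (hf : f (radius x) ≠ 0) (h₁ : ∀ s, 0 < s → HasDerivAt f (f₁ s) s)
    (h₂ : HasDerivAt f₁ f₂ (radius x)) (ν σ : Idx D) :
    ricci (staticMetric f) ν σ x =
      (f₂ / 2 + (D - 2) * f₁ (radius x) / (2 * radius x)) *
        (f (radius x) * (dtForm ν * dtForm σ) - (f (radius x))⁻¹ * (drForm x ν * drForm x σ))
      + (-f₁ (radius x) / radius x + (D - 3) * (1 - f (radius x)) / radius x ^ 2)
          * sph x ν σ := by
  simp only [ricci, riemannUp_staticMetric hr hf h₁ h₂]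
  have s₁ := sum_frame_mul hr ν σ (-(f (radius x))⁻¹ * drForm x ν) (-f (radius x) * dtForm ν) 0
    (f₂ / 2 * drForm x σ) (-(f₂ / 2) * dtForm σ) 0
  have s₂ := sum_frame_mul hr ν σ 1 0 0
    (-(f₁ (radius x) / (2 * radius x)) * sph x ν σ) 0
    (-(f₁ (radius x) / (2 * radius x)) * f (radius x) * dtForm ν)
  have s₃ := sum_frame_mul hr ν σ 0 1 0 0
    (-(f₁ (radius x) / (2 * radius x)) * sph x ν σ)
    (f₁ (radius x) / (2 * radius x) * (f (radius x))⁻¹ * drForm x ν)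
  have s₄ := sum_frame_mul hr ν σ 0 0 1 (f₁ (radius x) / (2 * radius x) * dtForm σ)
    (f₁ (radius x) / (2 * radius x) * drForm x σ) (-(1 - f (radius x)) / radius x ^ 2)
  -- The terms with `sph μ μ` are a full trace, contributing the rank `D - 2` of the projector; `s₁`
  -- to `s₄` cover the other contractions.
  have s₅ := congrArg (((f₁ (radius x) / (2 * radius x)) * (f (radius x) * dtForm ν * dtForm σ
    - (f (radius x))⁻¹ * drForm x ν * drForm x σ)
    + (1 - f (radius x)) / radius x ^ 2 * sph x ν σ) * ·) (sum_sph_self hD hr)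
  simp only [Finset.mul_sum] at s₅
  have h := congrArg₂ (· + ·) s₁ (congrArg₂ (· + ·) s₂ (congrArg₂ (· + ·) s₃
    (congrArg₂ (· + ·) s₄ s₅)))
  simp only [← Finset.sum_add_distrib] at h
  rw [Finset.sum_congr rfl fun α _ => ?_, h]
  · have := hr.ne'
    generalize f (radius x) = a at *
    field_simp
    ring
  · ring

theorem scalarCurvature_staticMetric (hD : 4 ≤ D) {f f₁ : ℝ → ℝ} {f₂ : ℝ} {x : Idx D → ℝ}
    (hr : 0 < radius x)
    (hf : f (radius x) ≠ 0) (h₁ : ∀ s, 0 < s → HasDerivAt f (f₁ s) s)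
    (h₂ : HasDerivAt f₁ f₂ (radius x)) :
    scalarCurvature (staticMetric f) x =
      -f₂ - 2 * (D - 2) * f₁ (radius x) / radius x
        + (D - 2) * (D - 3) * (1 - f (radius x)) / radius x ^ 2 := by
  simp only [scalarCurvature, ricci_staticMetric hD hr hf h₁ h₂, staticMetric_inv hr hf]
  set A := f₂ / 2 + (D - 2) * f₁ (radius x) / (2 * radius x) with hA
  set C := -f₁ (radius x) / radius x + (D - 3) * (1 - f (radius x)) / radius x ^ 2 with hC
  have inner : ∀ ν : Idx D, ∑ σ, (-(f (radius x))⁻¹ * (dtForm ν * dtForm σ)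
      + f (radius x) * (drForm x ν * drForm x σ) + sph x ν σ) *
      (A * (f (radius x) * (dtForm ν * dtForm σ) - (f (radius x))⁻¹ * (drForm x ν * drForm x σ))
        + C * sph x ν σ) =
      (dtForm ν * dtForm ν + drForm x ν * drForm x ν) * (-A) + C * sph x ν ν := by
    intro ν
    have h := sum_frame_mul hr ν ν (-(f (radius x))⁻¹ * dtForm ν) (f (radius x) * drForm x ν) 1
      (A * f (radius x) * dtForm ν) (-A * (f (radius x))⁻¹ * drForm x ν) C
    rw [Finset.sum_congr rfl fun α _ => ?_, h]
    · field_simp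
      ring
    · rw [sph_comm x α ν]
      ring
  simp only [inner, Finset.sum_add_distrib, ← Finset.sum_mul, ← Finset.mul_sum,
    sum_sph_self hD hr, sum_drForm_mul_drForm hr, sum_dtForm_mul]
  simp only [dtForm, if_true, hA, hC]
  have := hr.ne'
  field_simp
  ring

end StaticMetric

/-! ### Locality of the curvature. -/

section Congruence

variable {ι : Type} [DecidableEq ι]

theorem pd_congr {φ ψ : (ι → ℝ) → ℝ} {x : ι → ℝ} (h : φ =ᶠ[nhds x] ψ) (μ : ι) :
    pd μ φ x = pd μ ψ x := by
  rw [pd, pd, h.fderiv_eq]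

variable [Fintype ι]

theorem christoffel_congr {g g' : (ι → ℝ) → Matrix ι ι ℝ} {x : ι → ℝ}
    (h : g =ᶠ[nhds x] g') (μ ρ σ : ι) : christoffel g μ ρ σ x = christoffel g' μ ρ σ x := by
  have hpd : ∀ κ α β : ι, pd κ (fun y => g y α β) x = pd κ (fun y => g' y α β) x :=
    fun κ α β => pd_congr (h.mono fun y hy => by simp only [hy]) κ
  simp only [christoffel, hpd, h.eq_of_nhds]

/-- Two derivatives of the metric enter, so the symbols must agree near `x`, not only at `x`. -/
theorem riemannUp_congr {g g' : (ι → ℝ) → Matrix ι ι ℝ} {x : ι → ℝ}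
    (h : g =ᶠ[nhds x] g') (μ ν ρ σ : ι) : riemannUp g μ ν ρ σ x = riemannUp g' μ ν ρ σ x := by
  have hpd : ∀ κ α β γ : ι, pd κ (christoffel g α β γ) x = pd κ (christoffel g' α β γ) x :=
    fun κ α β γ => pd_congr
      (h.eventuallyEq_nhds.mono fun y hy => christoffel_congr hy α β γ) κ
  simp only [riemannUp, hpd, christoffel_congr h]

theorem weyl_congr {g g' : (ι → ℝ) → Matrix ι ι ℝ} {x : ι → ℝ}
    (h : g =ᶠ[nhds x] g') (μ ν ρ σ : ι) : weyl g μ ν ρ σ x = weyl g' μ ν ρ σ x := by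
  simp only [weyl, riemann, ricci, scalarCurvature, riemannUp_congr h, h.eq_of_nhds]

end Congruence

/-! ### Both tensors as multiples of `staticWeyl`. -/

section Weyl

variable {D : ℕ}

/-- The algebraic Weyl tensor invariant under the isometries of a static spherically symmetric
metric; it is unique up to scale. -/
def staticWeyl (f : ℝ → ℝ) (x : Idx D → ℝ) (μ ν ρ σ : Idx D) : ℝ :=
  (dtForm μ * drForm x ν - drForm x μ * dtForm ν) * (dtForm ρ * drForm x σ - drForm x ρ * dtForm σ)
    - f (radius x) / (D - 2) *
        (dtForm μ * (dtForm ρ * sph x ν σ - dtForm σ * sph x ν ρ)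
          + dtForm ν * (dtForm σ * sph x μ ρ - dtForm ρ * sph x μ σ))
    + (f (radius x))⁻¹ / (D - 2) *
        (drForm x μ * (drForm x ρ * sph x ν σ - drForm x σ * sph x ν ρ)
          + drForm x ν * (drForm x σ * sph x μ ρ - drForm x ρ * sph x μ σ))
    - 2 / ((D - 2) * (D - 3)) * (sph x μ ρ * sph x ν σ - sph x μ σ * sph x ν ρ)

/-- Removing the traces leaves a single combination of `f`, `f'`, `f''`; it vanishes for `f = 1 + br
+ cr²`, in particular for the constant-curvature case `b = 0`. -/
theorem weyl_staticMetric (hD : 4 ≤ D) {f f₁ : ℝ → ℝ} {f₂ : ℝ} {x : Idx D → ℝ}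
    (hr : 0 < radius x)
    (hf : f (radius x) ≠ 0) (h₁ : ∀ s, 0 < s → HasDerivAt f (f₁ s) s)
    (h₂ : HasDerivAt f₁ f₂ (radius x)) (μ ν ρ σ : Idx D) :
    weyl (staticMetric f) μ ν ρ σ x =
      (D - 3) / (2 * (D - 1)) *
        (f₂ - 2 * f₁ (radius x) / radius x + 2 * (f (radius x) - 1) / radius x ^ 2) *
        staticWeyl f x μ ν ρ σ := by
  have hD' : (4 : ℝ) ≤ D := by exact_mod_cast hD
  have d₁ : (D : ℝ) - 1 ≠ 0 := by linarith
  have d₂ : (D : ℝ) - 2 ≠ 0 := by linarith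
  have d₃ : (D : ℝ) - 3 ≠ 0 := by linarith
  simp only [weyl, card_idx hD, riemann_staticMetric hr hf h₁ h₂, ricci_staticMetric hD hr hf h₁ h₂,
    scalarCurvature_staticMetric hD hr hf h₁ h₂, staticMetric_apply, staticWeyl]
  rw [sph_comm x σ ν, sph_comm x ρ ν, sph_comm x σ μ, sph_comm x ρ μ]
  have := hr.ne'
  generalize f (radius x) = a at *
  field_simp
  ring

/-- `F` is `q` times an area form of the Lorentzian `(t, r)` plane, so its square is `-q²` times the
metric of that plane. -/
theorem dot1_staticMetric {f : ℝ → ℝ} {x : Idx D → ℝ} (hr : 0 < radius x)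
    (hf : f (radius x) ≠ 0) (q : ℝ) (μ ν : Idx D) :
    dot1 (staticMetric f x)
        (fun μ ν => q * (drForm x μ * dtForm ν - dtForm μ * drForm x ν)) μ ν =
      q ^ 2 * (f (radius x) * (dtForm μ * dtForm ν)
        - (f (radius x))⁻¹ * (drForm x μ * drForm x ν)) := by
  simp only [dot1, staticMetric_inv hr hf]
  have inner : ∀ κ : Idx D, ∑ l, (-(f (radius x))⁻¹ * (dtForm κ * dtForm l)
      + f (radius x) * (drForm x κ * drForm x l) + sph x κ l) *
        (q * (drForm x μ * dtForm κ - dtForm μ * drForm x κ)) *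
        (q * (drForm x ν * dtForm l - dtForm ν * drForm x l)) =
      (q * drForm x μ * dtForm κ + -q * dtForm μ * drForm x κ + 0 * sph x κ κ) *
        (-(f (radius x))⁻¹ * q * drForm x ν * dtForm κ + -f (radius x) * q * dtForm ν * drForm x κ
          + 0 * sph x κ κ) := by
    intro κ
    have h := sum_frame_mul hr κ κ (-(f (radius x))⁻¹ * dtForm κ) (f (radius x) * drForm x κ) 1
      (q * drForm x ν) (-q * dtForm ν) 0
    have h' := congrArg ((q * (drForm x μ * dtForm κ - dtForm μ * drForm x κ)) * ·) h
    simp only [Finset.mul_sum] at h'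
    rw [Finset.sum_congr rfl fun α _ => ?_, h']
    · ring
    · ring
  have h := sum_frame_mul hr μ ν (q * drForm x μ) (-q * dtForm μ) 0
    (-(f (radius x))⁻¹ * q * drForm x ν) (-f (radius x) * q * dtForm ν) 0
  rw [Finset.sum_congr rfl fun κ _ => inner κ]
  simp only [zero_mul, add_zero] at h ⊢
  rw [h]
  ring

theorem dot2_staticMetric {f : ℝ → ℝ} {x : Idx D → ℝ} (hr : 0 < radius x)
    (hf : f (radius x) ≠ 0) (q : ℝ) :
    dot2 (staticMetric f x)
        (fun μ ν => q * (drForm x μ * dtForm ν - dtForm μ * drForm x ν)) = -2 * q ^ 2 := by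
  simp only [dot2, dot1_staticMetric hr hf, staticMetric_inv hr hf]
  have inner : ∀ ν : Idx D, ∑ σ, (-(f (radius x))⁻¹ * (dtForm ν * dtForm σ)
      + f (radius x) * (drForm x ν * drForm x σ) + sph x ν σ) *
      (q ^ 2 * (f (radius x) * (dtForm ν * dtForm σ)
        - (f (radius x))⁻¹ * (drForm x ν * drForm x σ))) =
      (dtForm ν * dtForm ν + drForm x ν * drForm x ν) * (-q ^ 2) := by
    intro ν
    have h := sum_frame_mul hr ν ν (-(f (radius x))⁻¹ * dtForm ν) (f (radius x) * drForm x ν) 1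
      (q ^ 2 * f (radius x) * dtForm ν) (-q ^ 2 * (f (radius x))⁻¹ * drForm x ν) 0
    rw [Finset.sum_congr rfl fun α _ => ?_, h]
    · field_simp
      ring
    · ring
  simp only [inner, Finset.sum_add_distrib, ← Finset.sum_mul,
    sum_drForm_mul_drForm hr, sum_dtForm_mul]
  simp only [dtForm, if_true]
  ring

theorem doubling_staticMetric (hD : 4 ≤ D) {f : ℝ → ℝ} {x : Idx D → ℝ} (hr : 0 < radius x)
    (hf : f (radius x) ≠ 0) (q : ℝ) (μ ν ρ σ : Idx D) :
    doubling (staticMetric f x)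
        (fun μ ν => q * (drForm x μ * dtForm ν - dtForm μ * drForm x ν)) μ ν ρ σ =
      3 * (D - 3) / (2 * (D - 1)) * q ^ 2 * staticWeyl f x μ ν ρ σ := by
  have hD' : (4 : ℝ) ≤ D := by exact_mod_cast hD
  have d₁ : (D : ℝ) - 1 ≠ 0 := by linarith
  have d₂ : (D : ℝ) - 2 ≠ 0 := by linarith
  have d₃ : (D : ℝ) - 3 ≠ 0 := by linarith
  simp only [doubling, antisymPairs, card_idx hD, dot1_staticMetric hr hf, dot2_staticMetric hr hf,
    staticMetric_apply, staticWeyl]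
  generalize f (radius x) = a at *
  field_simp
  ring

end Weyl

/-! ### Specialisation to Reissner–Nordström. -/

section ReissnerNordstrom

variable {D : ℕ}

/-- Since `dω_k` is the `k`-th row of `sph` divided by `r`, `r² ∑ dω_k ⊗ dω_k` is `sph` composed
with itself, which is `sph`. The sum may include the time index, where `sph` vanishes. -/
theorem rnMetric_eq (M Q : ℝ) {x : Idx D → ℝ} (hr : 0 < radius x) :
    rnMetric D M Q x = staticMetric (rnF D M Q) x := by
  have hsph : ∀ (μ : Idx D) (k : Fin (D - 1)),
      pd μ (sphereProj k) x = sph x μ (Sum.inr k) / radius x :=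
    fun μ k => (hasGrad_drForm hr (Sum.inr k)).pd μ
  ext μ ν
  have h := sum_frame_mul hr μ ν 0 0 1 0 0 1
  simp only [zero_mul, one_mul, zero_add, Fintype.sum_sum_type] at h
  have h0 : sph x μ (Sum.inl ()) = 0 := by
    simp [sph, kron, dtForm, drForm]
  simp only [rnMetric, Matrix.of_apply, staticMetric_apply, (hasGrad_time x).pd,
    (hasGrad_radius hr).pd, sphereMetric, hsph]
  rw [← h]
  simp only [Finset.univ_unique, Finset.sum_singleton, PUnit.default_eq_unit, h0, zero_mul, zero_add,
    Finset.mul_sum]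
  congr 1
  refine Finset.sum_congr rfl fun k _ => ?_
  rw [sph_comm x (Sum.inr k) ν]
  have := hr.ne'
  field_simp

theorem hasDerivAt_const_div_pow (c : ℝ) (k : ℕ) {s : ℝ} (hs : s ≠ 0) :
    HasDerivAt (fun s : ℝ => c / s ^ k) (-(k * c) / s ^ (k + 1)) s := by
  have h := (hasDerivAt_const s c).div (hasDerivAt_pow k s) (pow_ne_zero k hs)
  refine h.congr_deriv ?_
  rcases k with _ | k
  · simp
  · simp only [Nat.add_sub_cancel]
    field_simp
    ring

theorem hasDerivAt_rnF (D : ℕ) (M Q : ℝ) {s : ℝ} (hs : s ≠ 0) :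
    HasDerivAt (rnF D M Q)
      ((D - 3 : ℕ) * (2 * M) / s ^ (D - 3 + 1)
        - (2 * (D - 3) : ℕ) * Q ^ 2 / s ^ (2 * (D - 3) + 1)) s :=
  (((hasDerivAt_const_div_pow (2 * M) (D - 3) hs).const_sub 1).add
    (hasDerivAt_const_div_pow (Q ^ 2) (2 * (D - 3)) hs)).congr_deriv (by ring)

theorem fieldStrength_rnGauge (Q : ℝ) {x : Idx D → ℝ} (hr : 0 < radius x) :
    fieldStrength (rnGauge D Q) x = fun μ ν =>
      (D - 3 : ℕ) * Q / radius x ^ (D - 3 + 1) *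
        (drForm x μ * dtForm ν - dtForm μ * drForm x ν) := by
  have h : ∀ ν : Idx D, HasGrad (fun y => rnGauge D Q y ν) _ x := fun ν =>
    ((hasGrad_radial hr (hasDerivAt_const_div_pow Q (D - 3) hr.ne').neg).mul
      (hasGrad_const (dtForm ν) x)).congr
      (Filter.Eventually.of_forall fun y => by simp [rnGauge, (hasGrad_time y).pd])
  funext μ ν
  simp only [fieldStrength, (h _).pd]
  ring

end ReissnerNordstrom
end RNDouble
end

theorem mainTheorem6 (D : ℕ) (hD : 4 ≤ D) (M Q : ℝ) (hQ : Q ≠ 0)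
    (x : RNDouble.Idx D → ℝ) (hr : 0 < RNDouble.radius x)
    (hf : RNDouble.rnF D M Q (RNDouble.radius x) ≠ 0) (μ ν ρ σ : RNDouble.Idx D) :
    RNDouble.weyl (RNDouble.rnMetric D M Q) μ ν ρ σ x =
      RNDouble.rnLambda D M Q (RNDouble.radius x) *
        RNDouble.doubling (RNDouble.rnMetric D M Q x)
          (RNDouble.fieldStrength (RNDouble.rnGauge D Q) x) μ ν ρ σ := by
  have h₂ := ((RNDouble.hasDerivAt_const_div_pow ((D - 3 : ℕ) * (2 * M)) (D - 3 + 1) hr.ne').sub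
    (RNDouble.hasDerivAt_const_div_pow ((2 * (D - 3) : ℕ) * Q ^ 2) (2 * (D - 3) + 1) hr.ne'))
  rw [RNDouble.weyl_congr ((RNDouble.eventually_radius_pos hr).mono
      fun y hy => RNDouble.rnMetric_eq M Q hy),
    RNDouble.weyl_staticMetric hD hr hf
      (fun s hs => RNDouble.hasDerivAt_rnF D M Q hs.ne') h₂,
    RNDouble.rnMetric_eq M Q hr, RNDouble.fieldStrength_rnGauge Q hr,
    RNDouble.doubling_staticMetric hD hr hf]
  simp only [← mul_assoc]
  -- Both sides are now a scalar times the same `staticWeyl`; only the scalars remain to be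
  -- compared.
  congr 1
  -- This turns the truncated exponent `D - 3` into `n + 1`.
  obtain ⟨n, rfl⟩ : ∃ n, D = n + 4 := ⟨D - 4, by omega⟩
  have e : n + 4 - 3 = n + 1 := rfl
  simp only [RNDouble.rnLambda, RNDouble.rnF, e]
  push_cast
  have hr' := hr.ne'
  have d₁ : (n : ℝ) + 4 - 1 ≠ 0 := by have := n.cast_nonneg (α := ℝ); linarith
  have d₃ : (n : ℝ) + 4 - 3 ≠ 0 := by have := n.cast_nonneg (α := ℝ); linarith
  field_simp
  ring
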